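/- Let $n\ge 2$ and $m\ge 1$, and let $B_j=\{z\in\mathbb{R}^n: |z-x_j|<r_j\}$, with $x_j\in\mathbb{R}^n$ and $r_j>0$, $j=1,\dots,m$, be balls in $\mathbb{R}^n$ such that $$|r_{j+1}-r_j|<|x_{j+1}-x_j|<r_j+r_{j+1}\qquad\text{for } 1\le j<m,$$ and $\overline{B_j}\cap\overline{B_k}=\emptyset$ whenever $|j-k|>1$. Then $D=B_1\cup B_2\cup\dots\cup B_m$ is a quasiball. Here a domain (non-empty connected open set) $G$ in $\overline{\mathbb{R}}^n=\mathbb{R}^n\cup\{\infty\}$, the one-point compactification of $\mathbb{R}^n$, is called a quasiball if for some $K\in[1,\infty)$ there is a $K$-quasiconformal mapping $f$ of $\overline{\mathbb{R}}^n$ onto itself with $G=f(\mathbb{B}^n)$, where $\mathbb{B}^n=\{z\in\mathbb{R}^n:|z|<1\}$. A homeomorphism $f$ of $\overline{\mathbb{R}}^n$ onto itself is $K$-quasiconformal if its restriction to the domain $\mathbb{R}^n\setminus\{f^{-1}(\infty)\}$ is. A mapping $f\colon G\to\mathbb{R}^n$ of a domain $G\subset\mathbb{R}^n$ is $K$-quasiconformal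 if it is a homeomorphism of $G$ onto $f(G)$, belongs to the Sobolev space $W^{1,n}_{\mathrm{loc}}(G)$, and its formal derivative $f'(x)$, with $J_f=\det f'$, satisfies $$|f'(x)|^n\le K J_f(x)\quad\text{and}\quad J_f(x)\le K\,l(f'(x))^n\qquad\text{for a.e. } x\in G,$$ where $|A|=\max_{|h|=1}|Ah|$ and $l(A)=\min_{|h|=1}|Ah|$. -/

import Mathlib

open MeasureTheory Metric Set
open scoped ContDiff ENNReal

namespace UnionsOfBalls

/-- `D` is a weak (formal) derivative of `f` on `G`: it is locally integrable in `G`, and for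
every real test function `φ ∈ C_c^∞(G)` and every direction `v`,
`∫ (∂_v φ) f dm = - ∫ φ (D v) dm`. -/
structure IsWeakDerivOn {n : ℕ} (G : Set (EuclideanSpace ℝ (Fin n)))
    (f : EuclideanSpace ℝ (Fin n) → EuclideanSpace ℝ (Fin n))
    (D : EuclideanSpace ℝ (Fin n) → EuclideanSpace ℝ (Fin n) →L[ℝ] EuclideanSpace ℝ (Fin n)) :
    Prop where
  integrableOn : ∀ C : Set (EuclideanSpace ℝ (Fin n)), IsCompact C → C ⊆ G →
    IntegrableOn D C volume
  integral_eq : ∀ φ : EuclideanSpace ℝ (Fin n) → ℝ, ContDiff ℝ ∞ φ → HasCompactSupport φ →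
    tsupport φ ⊆ G → ∀ v : EuclideanSpace ℝ (Fin n),
      ∫ y, (fderiv ℝ φ y v) • f y = - ∫ y, φ y • D y v

/-- `f` belongs to the Sobolev space `W^{1,n}_loc(G)` and `D` is its weak derivative. -/
structure MemW1nLocWith {n : ℕ} (G : Set (EuclideanSpace ℝ (Fin n)))
    (f : EuclideanSpace ℝ (Fin n) → EuclideanSpace ℝ (Fin n))
    (D : EuclideanSpace ℝ (Fin n) → EuclideanSpace ℝ (Fin n) →L[ℝ] EuclideanSpace ℝ (Fin n)) :
    Prop where
  isWeakDeriv : IsWeakDerivOn G f D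
  memLp : ∀ C : Set (EuclideanSpace ℝ (Fin n)), IsCompact C → C ⊆ G →
    MemLp f (n : ℝ≥0∞) (volume.restrict C)
  memLp_deriv : ∀ C : Set (EuclideanSpace ℝ (Fin n)), IsCompact C → C ⊆ G →
    MemLp D (n : ℝ≥0∞) (volume.restrict C)

/-- The minimal stretching `l(A) = min_{|h| = 1} |A h|` of a linear map. -/
noncomputable def minStretch {n : ℕ}
    (A : EuclideanSpace ℝ (Fin n) →L[ℝ] EuclideanSpace ℝ (Fin n)) : ℝ :=
  ⨅ h : sphere (0 : EuclideanSpace ℝ (Fin n)) 1, ‖A h‖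

/-- `f` is `K`-quasiregular in the domain `G ⊆ ℝⁿ`: it is continuous, belongs to
`W^{1,n}_loc(G)`, and its formal derivative satisfies `|f'|^n ≤ K J_f` (that is, `K_O(f) ≤ K`)
and `J_f ≤ K l(f')^n` (that is, `K_I(f) ≤ K`) almost everywhere in `G`. Weak derivatives are
unique up to null sets, so it does not matter which one is used. -/
structure IsQuasiregularOn {n : ℕ} (K : ℝ) (G : Set (EuclideanSpace ℝ (Fin n)))
    (f : EuclideanSpace ℝ (Fin n) → EuclideanSpace ℝ (Fin n)) : Prop where
  one_le : 1 ≤ K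
  isOpen : IsOpen G
  isConnected : IsConnected G
  continuousOn : ContinuousOn f G
  exists_deriv : ∃ D : EuclideanSpace ℝ (Fin n) →
      EuclideanSpace ℝ (Fin n) →L[ℝ] EuclideanSpace ℝ (Fin n),
    MemW1nLocWith G f D ∧
    (∀ᵐ y ∂(volume.restrict G), ‖D y‖ ^ n ≤ K * (D y).det) ∧
    (∀ᵐ y ∂(volume.restrict G), (D y).det ≤ K * minStretch (D y) ^ n)

/-- `f` is `K`-quasiconformal in the domain `G ⊆ ℝⁿ`: it is `K`-quasiregular and a homeomorphism
of `G` onto `f(G)`. -/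
structure IsQuasiconformalOn {n : ℕ} (K : ℝ) (G : Set (EuclideanSpace ℝ (Fin n)))
    (f : EuclideanSpace ℝ (Fin n) → EuclideanSpace ℝ (Fin n)) : Prop where
  isQuasiregularOn : IsQuasiregularOn K G f
  isEmbedding : Topology.IsEmbedding (G.domRestrict f)

/-- The set of the finite points `x ∈ ℝⁿ` that `f` maps to finite points,
`ℝⁿ \ {f⁻¹(∞)}` when `f` is a bijection. -/
def finiteDomain {n : ℕ}
    (f : OnePoint (EuclideanSpace ℝ (Fin n)) → OnePoint (EuclideanSpace ℝ (Fin n))) :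
    Set (EuclideanSpace ℝ (Fin n)) :=
  {y | f (y : OnePoint (EuclideanSpace ℝ (Fin n))) ≠ OnePoint.infty}

/-- The map `ℝⁿ → ℝⁿ` that agrees with `f` on `finiteDomain f` (its value elsewhere is `0` and
is never used). -/
def finitePart {n : ℕ}
    (f : OnePoint (EuclideanSpace ℝ (Fin n)) → OnePoint (EuclideanSpace ℝ (Fin n))) :
    EuclideanSpace ℝ (Fin n) → EuclideanSpace ℝ (Fin n) :=
  fun y => (f (y : OnePoint (EuclideanSpace ℝ (Fin n)))).elim 0 id

/-- A homeomorphism of the one-point compactification of `ℝⁿ` onto itself is `K`-quasiconformal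
if it is `K`-quasiconformal in the domain `ℝⁿ \ {f⁻¹(∞)}`. (Single points are removable for
quasiconformal homeomorphisms, so there is no further condition at `∞` and at `f⁻¹(∞)`.) -/
def IsQuasiconformalExtended {n : ℕ} (K : ℝ)
    (f : OnePoint (EuclideanSpace ℝ (Fin n)) ≃ₜ OnePoint (EuclideanSpace ℝ (Fin n))) : Prop :=
  IsQuasiconformalOn K (finiteDomain f) (finitePart f)

/-- A domain `G` in the extended space is a `K`-quasiball if it is the image of the unit ball
under a `K`-quasiconformal mapping of the extended space onto itself. -/
def IsKQuasiball {n : ℕ} (K : ℝ) (G : Set (OnePoint (EuclideanSpace ℝ (Fin n)))) : Prop :=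
  IsOpen G ∧ IsConnected G ∧
    ∃ f : OnePoint (EuclideanSpace ℝ (Fin n)) ≃ₜ OnePoint (EuclideanSpace ℝ (Fin n)),
      IsQuasiconformalExtended K f ∧
        G = f '' ((fun y : EuclideanSpace ℝ (Fin n) =>
          (y : OnePoint (EuclideanSpace ℝ (Fin n)))) '' ball 0 1)

/-- A quasiball is a `K`-quasiball for some `K ∈ [1, ∞)`. -/
def IsQuasiball {n : ℕ} (G : Set (OnePoint (EuclideanSpace ℝ (Fin n)))) : Prop :=
  ∃ K : ℝ, 1 ≤ K ∧ IsKQuasiball K G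

end UnionsOfBalls

/-! The union `D` is the image of the unit ball under a bilipschitz homeomorphism of ℝⁿ whose
Jacobian is a.e. bounded below by a positive constant. Such a map is quasiconformal, and it extends
to the compactification by fixing `∞` (`isQuasiball_image`).

The map is built by adding one ball at a time (`exists_image_ball_eq_iUnion`). Consecutive balls
overlap, so a homeomorphism can collapse `B_i ∪ B_{i+1}` onto `B_i`. It moves points only near
`closure B_{i+1}`, which is disjoint from the closures of the balls before `B_i`, so those balls
stay fixed. Its inverse attaches `B_{i+1}` to what has been built.

The collapse (`exists_image_union_eq_of_zero_mem`) is radial about a common point of two convex sets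
`A` and `B`, taken as the origin. With `N = gauge A` and `M = min (gauge A) (gauge B)`, the union is
`{M < 1}`, and its boundary point `v` must travel to `v / N v`. A Lipschitz field prescribes this
displacement; a small multiple of it is a contraction, so identity minus that multiple is a
homeomorphism with controlled Jacobian. Iterating it completes the journey. -/

namespace UnionsOfBalls

open Filter Topology
open scoped NNReal

/-! ### Bilipschitz homeomorphisms with Jacobian bounded below -/

section Bilipschitz

variable {E : Type*} [NormedAddCommGroup E] [NormedSpace ℝ E] [MeasurableSpace E]

/-- A bilipschitz homeomorphism whose Jacobian determinant is bounded below by a positive constant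
almost everywhere. -/
structure IsOrientedBilipschitz (μ : Measure E) (e : E ≃ₜ E) : Prop where
  lipschitz : ∃ K, LipschitzWith K e
  lipschitz_symm : ∃ K, LipschitzWith K e.symm
  det_lower : ∃ c : ℝ, 0 < c ∧ ∀ᵐ x ∂μ, c ≤ (fderiv ℝ e x).det

variable [FiniteDimensional ℝ E] [BorelSpace E] {μ : Measure E} [μ.IsAddHaarMeasure]

/-- A Lipschitz inverse multiplies Hausdorff measure of dimension `dim E` by at most a constant, and
that measure has the same null sets as `μ`. This lets a.e. statements be pulled back along `e` in
the chain rule. -/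
theorem quasiMeasurePreserving_of_lipschitz_symm (e : E ≃ₜ E) {K : ℝ≥0}
    (he : LipschitzWith K e.symm) : Measure.QuasiMeasurePreserving e μ μ := by
  refine ⟨e.continuous.measurable, Measure.AbsolutelyContinuous.mk fun s hs h0 => ?_⟩
  have h1 : (μH[Module.finrank ℝ E] : Measure E) s = 0 :=
    Measure.absolutelyContinuous_isAddHaarMeasure _ μ h0
  rw [Measure.map_apply e.continuous.measurable hs]
  refine Measure.absolutelyContinuous_isAddHaarMeasure μ
    (μH[Module.finrank ℝ E] : Measure E) ?_
  rw [← e.image_symm]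
  refine le_antisymm ((he.hausdorffMeasure_image_le (by positivity) s).trans ?_) bot_le
  simp [h1]

namespace IsOrientedBilipschitz

theorem trans {e f : E ≃ₜ E} (he : IsOrientedBilipschitz μ e) (hf : IsOrientedBilipschitz μ f) :
    IsOrientedBilipschitz μ (e.trans f) := by
  obtain ⟨⟨K, hK⟩, ⟨K', hK'⟩, c, hc, hec⟩ := he
  obtain ⟨⟨M, hM⟩, ⟨M', hM'⟩, d, hd, hfd⟩ := hf
  refine ⟨⟨_, hM.comp hK⟩, ⟨_, hK'.comp hM'⟩, d * c, by positivity, ?_⟩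
  have hq := quasiMeasurePreserving_of_lipschitz_symm (μ := μ) e hK'
  filter_upwards [hec, hq.ae hfd, hK.ae_differentiableAt (μ := μ),
    hq.ae (hM.ae_differentiableAt (μ := μ))] with x h1 h2 h3 h4
  have : fderiv ℝ (e.trans f) x = (fderiv ℝ f (e x)).comp (fderiv ℝ e x) := fderiv_comp x h4 h3
  rw [this, ContinuousLinearMap.det, ContinuousLinearMap.toLinearMap_comp, LinearMap.det_comp]
  exact mul_le_mul h2 h1 hc.le (hd.le.trans h2)

theorem symm {e : E ≃ₜ E} (he : IsOrientedBilipschitz μ e) : IsOrientedBilipschitz μ e.symm := by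
  obtain ⟨⟨K, hK⟩, ⟨M, hM⟩, c, hc, hdet⟩ := he
  obtain ⟨C, hC⟩ := (isCompact_closedBall (0 : E →L[ℝ] E) K).exists_bound_of_continuousOn
    ContinuousLinearMap.continuous_det.continuousOn
  refine ⟨⟨M, hM⟩, ⟨K, hK⟩, (max C 1)⁻¹, by positivity, ?_⟩
  have hq := quasiMeasurePreserving_of_lipschitz_symm (μ := μ) e.symm hK
  filter_upwards [hq.ae hdet, hM.ae_differentiableAt (μ := μ),
    hq.ae (hK.ae_differentiableAt (μ := μ))] with y h1 h2 h3
  have h4 : (fderiv ℝ e (e.symm y)).comp (fderiv ℝ e.symm y) = ContinuousLinearMap.id ℝ E := by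
    rw [← fderiv_comp y h3 h2, e.self_comp_symm]
    exact fderiv_id
  have h5 : (fderiv ℝ e (e.symm y)).det * (fderiv ℝ e.symm y).det = 1 := by
    rw [ContinuousLinearMap.det, ContinuousLinearMap.det, ← LinearMap.det_comp,
      ← ContinuousLinearMap.toLinearMap_comp, h4, ContinuousLinearMap.coe_id, LinearMap.det_id]
  have h6 : (fderiv ℝ e (e.symm y)).det ≤ max C 1 :=
    ((le_abs_self _).trans (hC _ (mem_closedBall_zero_iff.2
      (norm_fderiv_le_of_lipschitz ℝ hK)))).trans (le_max_left _ _)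
  rw [eq_inv_of_mul_eq_one_right h5]
  exact inv_anti₀ (hc.trans_le h1) h6

variable (μ) in
omit [FiniteDimensional ℝ E] [BorelSpace E] [μ.IsAddHaarMeasure] in
theorem refl : IsOrientedBilipschitz μ (Homeomorph.refl E) := by
  refine ⟨⟨1, LipschitzWith.id⟩, ⟨1, LipschitzWith.id⟩, 1, one_pos, .of_forall fun x => ?_⟩
  have : fderiv ℝ (Homeomorph.refl E) x = ContinuousLinearMap.id ℝ E := fderiv_id
  rw [this, ContinuousLinearMap.det, ContinuousLinearMap.coe_id, LinearMap.det_id]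

variable (μ) in
omit [BorelSpace E] [μ.IsAddHaarMeasure] in
theorem similarity {r : ℝ} (hr : 0 < r) (a : E) :
    IsOrientedBilipschitz μ
      ((Homeomorph.smulOfNeZero r hr.ne').trans (Homeomorph.addRight a)) := by
  refine ⟨⟨‖r‖₊, LipschitzWith.of_dist_le_mul fun x y => ?_⟩,
    ⟨‖r⁻¹‖₊, LipschitzWith.of_dist_le_mul fun x y => ?_⟩,
    r ^ Module.finrank ℝ E, by positivity, .of_forall fun x => ?_⟩
  · simp [dist_smul₀]
  · simp [dist_smul₀, Homeomorph.addRight_symm]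
  · have h : HasFDerivAt ((Homeomorph.smulOfNeZero r hr.ne').trans (Homeomorph.addRight a))
        (r • ContinuousLinearMap.id ℝ E) x :=
      ((hasFDerivAt_id x).const_smul r).add_const a
    rw [h.fderiv, ContinuousLinearMap.det, ContinuousLinearMap.toLinearMap_smul,
      ContinuousLinearMap.coe_id, LinearMap.det_smul, LinearMap.det_id, mul_one]

omit [MeasurableSpace E] [BorelSpace E] in
-- If `‖A‖ < 1`, then `A v = -v` forces `v = 0`, so the determinant of `1 + A` has no zero on the
-- closed `q`-ball. That ball is connected and contains `A = 0`, so the determinant is positive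
-- there; compactness gives a positive minimum.
theorem exists_le_det_one_add {q : ℝ} (hq : q < 1) :
    ∃ c : ℝ, 0 < c ∧ ∀ A : E →L[ℝ] E, ‖A‖ ≤ q → c ≤ (ContinuousLinearMap.id ℝ E + A).det := by
  have hcont : Continuous fun A : E →L[ℝ] E => (ContinuousLinearMap.id ℝ E + A).det :=
    ContinuousLinearMap.continuous_det.comp (by fun_prop)
  have hne : ∀ A : E →L[ℝ] E, ‖A‖ ≤ q → (ContinuousLinearMap.id ℝ E + A).det ≠ 0 := by
    intro A hA h0
    obtain ⟨v, hv, hv0⟩ :=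
      (Submodule.ne_bot_iff _).1 (LinearMap.bot_lt_ker_of_det_eq_zero h0).ne'
    have h1 : A v = -v := by
      have : v + A v = 0 := hv
      exact (neg_eq_of_add_eq_zero_right this).symm
    have h2 : ‖v‖ ≤ q * ‖v‖ := by
      simpa [h1] using A.le_of_opNorm_le hA v
    nlinarith [norm_pos_iff.2 hv0]
  rcases lt_or_ge q 0 with hq0 | hq0
  · exact ⟨1, one_pos, fun A hA => absurd (norm_nonneg A) (by linarith)⟩
  have hpos : ∀ A ∈ closedBall (0 : E →L[ℝ] E) q, 0 < (ContinuousLinearMap.id ℝ E + A).det := by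
    intro A hA
    by_contra hneg
    have h0 : (0 : E →L[ℝ] E) ∈ closedBall (0 : E →L[ℝ] E) q := mem_closedBall_self hq0
    have h1 : (0 : ℝ) ≤ (ContinuousLinearMap.id ℝ E + (0 : E →L[ℝ] E)).det := by
      rw [add_zero, ContinuousLinearMap.det, ContinuousLinearMap.coe_id, LinearMap.det_id]
      exact zero_le_one
    obtain ⟨B, hB, hB0⟩ := (convex_closedBall (0 : E →L[ℝ] E) q).isPreconnected.intermediate_value
      hA h0 hcont.continuousOn ⟨not_lt.1 hneg, h1⟩
    exact hne B (mem_closedBall_zero_iff.1 hB) hB0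
  obtain ⟨A, hA, hmin⟩ := (isCompact_closedBall (0 : E →L[ℝ] E) q).exists_isMinOn
    ⟨0, mem_closedBall_self hq0⟩ hcont.continuousOn
  exact ⟨_, hpos A hA, fun B hB => hmin (mem_closedBall_zero_iff.2 hB)⟩

variable (μ) in
/-- A contractive perturbation of the identity is an oriented bilipschitz homeomorphism. -/
theorem exists_id_add {w : E → E} {q : ℝ≥0} (hw : LipschitzWith q w) (hq : q < 1) :
    ∃ e : E ≃ₜ E, IsOrientedBilipschitz μ e ∧ ∀ v, e v = v + w v := by
  have happ : ApproximatesLinearOn (fun v => v + w v)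
      ((ContinuousLinearEquiv.refl ℝ E : E ≃L[ℝ] E) : E →L[ℝ] E) univ q := by
    intro x _ y _
    have : x + w x - (y + w y) - (x - y) = w x - w y := by abel
    simpa [this] using hw.norm_sub_le x y
  have hc : Subsingleton E ∨
      q < ‖((ContinuousLinearEquiv.refl ℝ E : E ≃L[ℝ] E).symm : E →L[ℝ] E)‖₊⁻¹ := by
    rcases subsingleton_or_nontrivial E with h | h
    · exact .inl h
    · right
      have : ‖ContinuousLinearMap.id ℝ E‖₊ = 1 := by ext; simp
      simpa [this] using hq
  let e := happ.toHomeomorph _ hc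
  have he : ∀ v, e v = v + w v := fun v => rfl
  have hLip : LipschitzWith (1 + q) e := LipschitzWith.id.add hw
  refine ⟨e, ⟨⟨_, hLip⟩, ?_, ?_⟩, he⟩
  · have h1 : AntilipschitzWith _ e := AntilipschitzWith.of_le_mul_dist fun x y => by
      have := (happ.antilipschitz hc).le_mul_dist ⟨x, mem_univ x⟩ ⟨y, mem_univ y⟩
      exact this
    exact ⟨_, h1.to_rightInverse e.right_inv⟩
  · obtain ⟨c, hc0, hcA⟩ := exists_le_det_one_add (E := E) (q := q) (by exact_mod_cast hq)
    refine ⟨c, hc0, ?_⟩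
    filter_upwards [hw.ae_differentiableAt (μ := μ)] with x hx
    have : fderiv ℝ e x = ContinuousLinearMap.id ℝ E + fderiv ℝ w x :=
      ((hasFDerivAt_id x).add hx.hasFDerivAt).fderiv
    rw [this]
    exact hcA _ (norm_fderiv_le_of_lipschitz ℝ hw)

theorem exists_iterate {e : E ≃ₜ E} (he : IsOrientedBilipschitz μ e) (k : ℕ) :
    ∃ f : E ≃ₜ E, IsOrientedBilipschitz μ f ∧ ⇑f = e^[k] := by
  induction k with
  | zero => exact ⟨_, refl μ, rfl⟩
  | succ k ih =>
    obtain ⟨f, hf, hfe⟩ := ih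
    exact ⟨e.trans f, he.trans hf, by rw [Function.iterate_succ, ← hfe]; rfl⟩

end IsOrientedBilipschitz

end Bilipschitz

/-! ### From bilipschitz maps to quasiconformal maps -/

section Quasiconformal

theorem norm_le_mul_norm_fderiv {E F : Type*} [NormedAddCommGroup E] [NormedSpace ℝ E]
    [NormedAddCommGroup F] [NormedSpace ℝ F] {f : E → F} {M : ℝ≥0} (hf : AntilipschitzWith M f)
    {x : E} (hx : DifferentiableAt ℝ f x) (v : E) : ‖v‖ ≤ M * ‖fderiv ℝ f x v‖ := by
  refine ge_of_tendsto
    (((hx.hasFDerivAt.hasLineDerivAt v).tendsto_slope_zero_right.norm).const_mul (M : ℝ)) ?_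
  filter_upwards [self_mem_nhdsWithin] with t ht
  have ht : 0 < t := ht
  have := hf.le_mul_dist (x + t • v) x
  rw [dist_self_add_left, norm_smul, Real.norm_of_nonneg ht.le, dist_eq_norm] at this
  rw [norm_smul, norm_inv, Real.norm_of_nonneg ht.le, mul_left_comm, inv_mul_eq_div,
    le_div_iff₀' ht]
  exact this

variable {n : ℕ}

/-- By Rademacher's theorem the classical derivative exists a.e.; integration by parts for Lipschitz
functions is then applied to each coordinate. -/
theorem LipschitzWith.isWeakDerivOn_fderiv
    {f : EuclideanSpace ℝ (Fin n) → EuclideanSpace ℝ (Fin n)} {K : ℝ≥0} (hf : LipschitzWith K f)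
    (G : Set (EuclideanSpace ℝ (Fin n))) : IsWeakDerivOn G f (fderiv ℝ f) := by
  have hmeas : AEStronglyMeasurable (fderiv ℝ f) volume :=
    (measurable_fderiv ℝ f).aestronglyMeasurable
  have hbound : ∀ x, ‖fderiv ℝ f x‖ ≤ K := fun x => norm_fderiv_le_of_lipschitz ℝ hf
  have hint : LocallyIntegrable (fderiv ℝ f) volume := by
    refine (locallyIntegrable_const (K : ℝ)).mono hmeas (.of_forall fun x => ?_)
    simpa using hbound x
  refine ⟨fun C hC _ => hint.integrableOn_isCompact hC, fun φ hφ hφc _ v => ?_⟩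
  have hφd : Continuous fun y => fderiv ℝ φ y v :=
    (hφ.continuous_fderiv (by simp)).clm_apply continuous_const
  have hφdc : HasCompactSupport fun y => fderiv ℝ φ y v :=
    (hφc.fderiv (𝕜 := ℝ)).comp_left (g := fun A : _ →L[ℝ] ℝ => A v) (by simp)
  have hL : Integrable (fun y => (fderiv ℝ φ y v) • f y) volume :=
    (hφd.smul hf.continuous).integrable_of_hasCompactSupport hφdc.smul_right
  have hR : Integrable (fun y => φ y • fderiv ℝ f y v) volume := by
    refine LocallyIntegrable.integrable_smul_left_of_hasCompactSupport ?_ hφ.continuous hφc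
    refine (locallyIntegrable_const ((K : ℝ) * ‖v‖)).mono
      (measurable_fderiv_apply_const ℝ f v).aestronglyMeasurable (.of_forall fun x => ?_)
    simpa using (fderiv ℝ f x).le_of_opNorm_le (hbound x) v
  obtain ⟨D, hD⟩ := ContDiff.lipschitzWith_of_hasCompactSupport hφc hφ (by simp)
  ext i
  let p : EuclideanSpace ℝ (Fin n) →L[ℝ] ℝ := EuclideanSpace.proj i
  change p (∫ y, (fderiv ℝ φ y v) • f y) = p (-∫ y, φ y • fderiv ℝ f y v)
  rw [map_neg, ← p.integral_comp_comm hL, ← p.integral_comp_comm hR]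
  have hpf : LipschitzWith (‖p‖₊ * K) fun y => p (f y) := p.lipschitz.comp hf
  have key := hpf.integral_lineDeriv_mul_eq (μ := volume) hD hφc v
  have h1 : ∫ y, p (φ y • fderiv ℝ f y v) = ∫ y, lineDeriv ℝ (fun y => p (f y)) y v * φ y := by
    refine integral_congr_ae ?_
    filter_upwards [hf.ae_differentiableAt (μ := volume)] with y hy
    have : HasFDerivAt (fun y => p (f y)) (p.comp (fderiv ℝ f y)) y :=
      p.hasFDerivAt.comp y hy.hasFDerivAt
    rw [(this.hasLineDerivAt v).lineDeriv, map_smul, smul_eq_mul, mul_comm]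
    rfl
  -- The integration by parts formula differentiates `φ` in direction `-v`, which accounts for the
  -- minus sign.
  have h2 : ∫ y, p (fderiv ℝ φ y v • f y) = - ∫ y, lineDeriv ℝ φ y (-v) * p (f y) := by
    rw [← integral_neg]
    refine integral_congr_ae (.of_forall fun y => ?_)
    have := (hφ.differentiable (by simp) y).hasFDerivAt
    simp only [(this.hasLineDerivAt (-v)).lineDeriv, map_smul, smul_eq_mul, map_neg, neg_mul,
      neg_neg]
  rw [h1, h2, key]

theorem LipschitzWith.memW1nLocWith_fderiv
    {f : EuclideanSpace ℝ (Fin n) → EuclideanSpace ℝ (Fin n)} {K : ℝ≥0} (hf : LipschitzWith K f)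
    (G : Set (EuclideanSpace ℝ (Fin n))) : MemW1nLocWith G f (fderiv ℝ f) := by
  refine ⟨LipschitzWith.isWeakDerivOn_fderiv hf G, fun C hC _ => ?_, fun C hC _ => ?_⟩
  · have := isFiniteMeasure_restrict.2 (hC.measure_lt_top (μ := volume)).ne
    obtain ⟨M, hM⟩ := hC.exists_bound_of_continuousOn hf.continuous.continuousOn
    exact MemLp.of_bound hf.continuous.aestronglyMeasurable M
      (ae_restrict_of_forall_mem hC.measurableSet hM)
  · have := isFiniteMeasure_restrict.2 (hC.measure_lt_top (μ := volume)).ne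
    exact MemLp.of_bound (measurable_fderiv ℝ f).aestronglyMeasurable K
      (.of_forall fun x => norm_fderiv_le_of_lipschitz ℝ hf)

theorem IsOrientedBilipschitz.exists_isQuasiconformalOn (hn : 0 < n)
    {e : EuclideanSpace ℝ (Fin n) ≃ₜ EuclideanSpace ℝ (Fin n)}
    (he : IsOrientedBilipschitz volume e) : ∃ K, IsQuasiconformalOn K univ e := by
  obtain ⟨⟨L, hL⟩, ⟨M, hM⟩, c, hc, hdet⟩ := he
  obtain ⟨C, hC⟩ := (isCompact_closedBall
    (0 : EuclideanSpace ℝ (Fin n) →L[ℝ] EuclideanSpace ℝ (Fin n)) L).exists_bound_of_continuousOn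
    ContinuousLinearMap.continuous_det.continuousOn
  have : Nonempty (Fin n) := ⟨⟨0, hn⟩⟩
  have hne : Nonempty (sphere (0 : EuclideanSpace ℝ (Fin n)) 1) :=
    (NormedSpace.sphere_nonempty.2 zero_le_one).to_subtype
  have hMe : AntilipschitzWith M e := hM.to_rightInverse e.left_inv
  have hM0 : (0 : ℝ) < M := by
    obtain ⟨v, hv⟩ := hne
    have h1 := hMe.le_mul_dist v 0
    rw [mem_sphere_zero_iff_norm] at hv
    rw [dist_zero_right, hv] at h1
    by_contra hneg
    have : (M : ℝ) = 0 := le_antisymm (not_lt.1 hneg) M.coe_nonneg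
    rw [this, zero_mul] at h1
    linarith
  -- Here `‖e'‖ ≤ L`, `c ≤ det e' ≤ C` and `l(e') ≥ 1 / M` almost everywhere; the last two entries
  -- serve the two dilatation inequalities.
  let K : ℝ := max 1 (max (L ^ n / c) (C * M ^ n))
  refine ⟨K, ⟨le_max_left _ _, isOpen_univ, isConnected_univ, e.continuous.continuousOn,
    fderiv ℝ e, LipschitzWith.memW1nLocWith_fderiv hL univ, ?_, ?_⟩, ?_⟩
  · rw [Measure.restrict_univ]
    filter_upwards [hdet] with y hy
    calc ‖fderiv ℝ e y‖ ^ n ≤ L ^ n := by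
          gcongr; exact norm_fderiv_le_of_lipschitz ℝ hL
      _ = L ^ n / c * c := by field_simp
      _ ≤ K * (fderiv ℝ e y).det := by
          gcongr
          exact (le_max_left _ _).trans (le_max_right _ _)
  · rw [Measure.restrict_univ]
    filter_upwards [hL.ae_differentiableAt (μ := volume)] with y hy
    have h1 : (M : ℝ)⁻¹ ≤ minStretch (fderiv ℝ e y) := by
      refine le_ciInf fun h => ?_
      have hh : ‖(h : EuclideanSpace ℝ (Fin n))‖ = 1 := mem_sphere_zero_iff_norm.1 h.2
      have := norm_le_mul_norm_fderiv hMe hy h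
      rw [hh] at this
      rwa [inv_le_iff_one_le_mul₀' hM0]
    have h2 : (fderiv ℝ e y).det ≤ C :=
      (le_abs_self _).trans (hC _ (mem_closedBall_zero_iff.2 (norm_fderiv_le_of_lipschitz ℝ hL)))
    have hC0 : 0 ≤ C := (norm_nonneg _).trans (hC 0 (mem_closedBall_self L.coe_nonneg))
    calc (fderiv ℝ e y).det ≤ C := h2
      _ = C * M ^ n * (M : ℝ)⁻¹ ^ n := by
          rw [mul_assoc, ← mul_pow, mul_inv_cancel₀ hM0.ne', one_pow, mul_one]
      _ ≤ K * minStretch (fderiv ℝ e y) ^ n := by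
          gcongr
          exact (le_max_right _ _).trans (le_max_right _ _)
  · exact e.isEmbedding.comp .subtypeVal

theorem isQuasiball_image (hn : 0 < n)
    {e : EuclideanSpace ℝ (Fin n) ≃ₜ EuclideanSpace ℝ (Fin n)}
    (he : IsOrientedBilipschitz volume e) :
    IsQuasiball ((fun y : EuclideanSpace ℝ (Fin n) =>
      (y : OnePoint (EuclideanSpace ℝ (Fin n)))) '' (e '' ball 0 1)) := by
  obtain ⟨K, hK⟩ := he.exists_isQuasiconformalOn hn
  refine ⟨K, hK.isQuasiregularOn.one_le, ?_, ?_, e.onePointCongr, ?_, ?_⟩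
  · exact OnePoint.isOpenEmbedding_coe.isOpenMap _ (e.isOpenMap _ isOpen_ball)
  · exact (((convex_ball 0 1).isConnected ⟨0, mem_ball_self one_pos⟩).image _
      e.continuous.continuousOn).image _ OnePoint.continuous_coe.continuousOn
  · have h1 : finiteDomain e.onePointCongr = univ := eq_univ_of_forall fun y => by
      simp [finiteDomain]
    have h2 : finitePart e.onePointCongr = e := by
      ext1 y
      simp [finitePart]
    rw [IsQuasiconformalExtended, h1, h2]
    exact hK
  · rw [image_image, image_image]
    rfl

end Quasiconformal

/-! ### Algebra of bounded Lipschitz functions and cutoffs -/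

section BoundedLipschitz

variable {E F : Type*} [NormedAddCommGroup E] [NormedAddCommGroup F] [NormedSpace ℝ F]

/-- `f` is bounded and Lipschitz on `S`. -/
def BoundedLipschitzOn (f : E → F) (S : Set E) : Prop :=
  ∃ C : ℝ, 0 ≤ C ∧ (∀ x ∈ S, ‖f x‖ ≤ C) ∧ ∀ x ∈ S, ∀ y ∈ S, ‖f x - f y‖ ≤ C * ‖x - y‖

namespace BoundedLipschitzOn

variable {S : Set E}

omit [NormedSpace ℝ F] in
theorem of_lipschitzWith {f : E → F} {K : ℝ≥0} (hf : LipschitzWith K f)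
    (hS : Bornology.IsBounded S) : BoundedLipschitzOn f S := by
  obtain ⟨C, hC⟩ := (hf.isBounded_image hS).exists_norm_le
  refine ⟨max K C, K.coe_nonneg.trans (le_max_left _ _),
    fun x hx => (hC _ (mem_image_of_mem f hx)).trans (le_max_right _ _), fun x _ y _ => ?_⟩
  exact (hf.norm_sub_le x y).trans (by gcongr; exact le_max_left _ _)

omit [NormedSpace ℝ F] in
theorem sub {f g : E → F} (hf : BoundedLipschitzOn f S) (hg : BoundedLipschitzOn g S) :
    BoundedLipschitzOn (fun x => f x - g x) S := by
  obtain ⟨C, hC, hf1, hf2⟩ := hf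
  obtain ⟨D, hD, hg1, hg2⟩ := hg
  refine ⟨C + D, by positivity, fun x hx => ?_, fun x hx y hy => ?_⟩
  · exact (norm_sub_le _ _).trans (add_le_add (hf1 x hx) (hg1 x hx))
  · rw [sub_sub_sub_comm, add_mul]
    exact (norm_sub_le _ _).trans (add_le_add (hf2 x hx y hy) (hg2 x hx y hy))

theorem smul {f : E → ℝ} {g : E → F} (hf : BoundedLipschitzOn f S)
    (hg : BoundedLipschitzOn g S) : BoundedLipschitzOn (fun x => f x • g x) S := by
  obtain ⟨C, hC, hf1, hf2⟩ := hf
  obtain ⟨D, hD, hg1, hg2⟩ := hg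
  refine ⟨2 * (C * D), by positivity, fun x hx => ?_, fun x hx y hy => ?_⟩
  · rw [norm_smul]
    nlinarith [mul_le_mul (hf1 x hx) (hg1 x hx) (norm_nonneg _) hC, mul_nonneg hC hD]
  · have h : f x • g x - f y • g y = f x • (g x - g y) + (f x - f y) • g y := by
      rw [smul_sub, sub_smul]; abel
    calc ‖f x • g x - f y • g y‖ ≤ ‖f x‖ * ‖g x - g y‖ + ‖f x - f y‖ * ‖g y‖ := by
          rw [h, ← norm_smul, ← norm_smul]; exact norm_add_le _ _
      _ ≤ C * (D * ‖x - y‖) + C * ‖x - y‖ * D := by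
          gcongr
          exacts [hf1 x hx, hg2 x hx y hy, hf2 x hx y hy, hg1 y hy]
      _ = 2 * (C * D) * ‖x - y‖ := by ring

theorem inv {f : E → ℝ} {c : ℝ} (hf : BoundedLipschitzOn f S) (hc : 0 < c)
    (hcf : ∀ x ∈ S, c ≤ f x) : BoundedLipschitzOn (fun x => (f x)⁻¹) S := by
  obtain ⟨C, hC, -, hf2⟩ := hf
  refine ⟨max c⁻¹ (C / (c * c)), (inv_pos.2 hc).le.trans (le_max_left _ _), fun x hx => ?_,
    fun x hx y hy => ?_⟩
  · have h0 := hc.trans_le (hcf x hx)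
    rw [Real.norm_of_nonneg (inv_pos.2 h0).le]
    exact (inv_anti₀ hc (hcf x hx)).trans (le_max_left _ _)
  · have h0 := hc.trans_le (hcf x hx)
    have h1 := hc.trans_le (hcf y hy)
    rw [inv_sub_inv h0.ne' h1.ne', norm_div, norm_mul, Real.norm_of_nonneg h0.le,
      Real.norm_of_nonneg h1.le]
    calc ‖f y - f x‖ / (f x * f y) ≤ C * ‖y - x‖ / (c * c) := by
          gcongr
          exacts [hf2 y hy x hx, hcf x hx, hcf y hy]
      _ = C / (c * c) * ‖x - y‖ := by rw [norm_sub_rev]; ring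
      _ ≤ _ := by gcongr; exact le_max_right _ _

/-- Multiplication by a cutoff function turns a Lipschitz function on `S` into a Lipschitz function
on the whole space. -/
theorem exists_lipschitzWith_smul {χ : E → ℝ} {f : E → F} (hχ : BoundedLipschitzOn χ univ)
    (hχS : ∀ x ∉ S, χ x = 0) (hf : BoundedLipschitzOn f S) :
    ∃ K, LipschitzWith K fun x => χ x • f x := by
  obtain ⟨C, hC, hχ1, hχ2⟩ := hχ
  obtain ⟨D, hD, hfχ1, hfχ2⟩ := smul (S := S) ⟨C, hC, fun x _ => hχ1 x trivial,
    fun x _ y _ => hχ2 x trivial y trivial⟩ hf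
  obtain ⟨B, hB, hf1, -⟩ := hf
  -- Nothing is known about `f` at `y`, but `χ y = 0`, so the Lipschitz bound for `χ` and the bound
  -- for `f x` suffice.
  have key : ∀ x ∈ S, ∀ y ∉ S, ‖χ x • f x‖ ≤ C * B * ‖x - y‖ := fun x hx y hy => by
    have := hχ2 x trivial y trivial
    rw [hχS y hy, sub_zero] at this
    rw [norm_smul, mul_right_comm]
    gcongr
    exact hf1 x hx
  refine ⟨⟨D + C * B, by positivity⟩, LipschitzWith.of_dist_le_mul fun x y => ?_⟩
  rw [dist_eq_norm, dist_eq_norm]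
  change _ ≤ (D + C * B) * _
  have h1 : 0 ≤ D * ‖x - y‖ := by positivity
  have h2 : 0 ≤ C * B * ‖x - y‖ := by positivity
  rw [add_mul]
  by_cases hx : x ∈ S <;> by_cases hy : y ∈ S
  · linarith [hfχ2 x hx y hy]
  · rw [hχS y hy, zero_smul, sub_zero]
    linarith [key x hx y hy]
  · rw [hχS x hx, zero_smul, zero_sub, norm_neg]
    have := key y hy x hx
    rw [norm_sub_rev] at this
    linarith
  · rw [hχS x hx, hχS y hy, zero_smul, zero_smul, sub_zero, norm_zero]
    positivity

end BoundedLipschitzOn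

end BoundedLipschitz

/-! ### Radial collapse of a union of two convex sets -/

section Collapse

variable {E : Type*} [NormedAddCommGroup E] [NormedSpace ℝ E] [MeasurableSpace E]
  [FiniteDimensional ℝ E] [BorelSpace E] {μ : Measure E} [μ.IsAddHaarMeasure]

omit [FiniteDimensional ℝ E] [MeasurableSpace E] [BorelSpace E] in
theorem exists_mul_norm_le_gauge {A : Set E} (hA : A ∈ 𝓝 (0 : E))
    (hAb : Bornology.IsBounded A) : ∃ c : ℝ, 0 < c ∧ ∀ v, c * ‖v‖ ≤ gauge A v := by
  obtain ⟨R, hR, hAR⟩ := hAb.subset_closedBall_lt 0 0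
  refine ⟨R⁻¹, inv_pos.2 hR, fun v => ?_⟩
  rw [inv_mul_eq_div]
  exact le_gauge_of_subset_closedBall (absorbent_nhds_zero hA) hR.le hAR

omit [MeasurableSpace E] [BorelSpace E] in
/-- The radial displacement field that is used to push `A ∪ B` onto `A`. -/
theorem exists_radial_field {A B U : Set E} (hA : Convex ℝ A) (hAo : IsOpen A)
    (hAb : Bornology.IsBounded A) (hA0 : (0 : E) ∈ A) (hB : Convex ℝ B) (hBo : IsOpen B)
    (hBb : Bornology.IsBounded B) (hB0 : (0 : E) ∈ B) (hU : IsOpen U) (hBU : closure B ⊆ U) :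
    ∃ (χ : E → ℝ) (K : ℝ≥0), (∀ v ∉ U, χ v = 0) ∧ (∀ v ∈ closure B \ A, χ v = 1) ∧
      LipschitzWith K fun v =>
        χ v • ((min (gauge A v) (gauge B v))⁻¹ - (gauge A v)⁻¹) • v := by
  have hAn := hAo.mem_nhds hA0
  have hBn := hBo.mem_nhds hB0
  obtain ⟨ε₁, hε₁, hε₁U⟩ := hBb.isCompact_closure.exists_thickening_subset_open hU hBU
  obtain ⟨ε₂, hε₂, hε₂A⟩ := Metric.isOpen_iff.1 hAo 0 hA0
  obtain ⟨a, ha, haA⟩ := exists_mul_norm_le_gauge hAn hAb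
  obtain ⟨b, hb, hbB⟩ := exists_mul_norm_le_gauge hBn hBb
  obtain ⟨KA, hKA⟩ := hA.lipschitz_gauge hAn
  obtain ⟨KB, hKB⟩ := hB.lipschitz_gauge hBn
  -- The bound `ε₁` keeps the cutoff region inside `U`. Points outside `A` have norm at least `ε₂`,
  -- so `ε₂ / 2` keeps the region away from the origin, where the reciprocals of the gauges are
  -- singular.
  have hε : 0 < min ε₁ (ε₂ / 2) := by positivity
  set ε := min ε₁ (ε₂ / 2)
  let S := thickening ε (closure B \ A)
  have hSU : S ⊆ U := (thickening_mono (min_le_left _ _) _).trans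
    ((thickening_subset_of_subset _ sdiff_subset).trans hε₁U)
  have hSb : Bornology.IsBounded S := (hBb.closure.subset sdiff_subset).thickening
  have hS0 : ∀ v ∈ S, ε₂ / 2 ≤ ‖v‖ := fun v hv => by
    obtain ⟨z, hz, hvz⟩ := mem_thickening_iff.1 hv
    have h1 : ε₂ ≤ ‖z‖ := by
      by_contra hlt
      exact hz.2 (hε₂A (mem_ball_zero_iff.2 (not_le.1 hlt)))
    have h2 : ‖z‖ - ‖v‖ ≤ dist v z := by
      rw [dist_comm, dist_eq_norm]; exact norm_sub_norm_le z v
    linarith [hvz.trans_le (min_le_right ε₁ (ε₂ / 2))]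
  have hAS : ∀ v ∈ S, a * (ε₂ / 2) ≤ gauge A v := fun v hv =>
    (mul_le_mul_of_nonneg_left (hS0 v hv) ha.le).trans (haA v)
  have hBS : ∀ v ∈ S, b * (ε₂ / 2) ≤ gauge B v := fun v hv =>
    (mul_le_mul_of_nonneg_left (hS0 v hv) hb.le).trans (hbB v)
  have hLA : BoundedLipschitzOn (fun v => (gauge A v)⁻¹) S :=
    (BoundedLipschitzOn.of_lipschitzWith hKA hSb).inv (by positivity) hAS
  have hLM : BoundedLipschitzOn (fun v => (min (gauge A v) (gauge B v))⁻¹) S :=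
    (BoundedLipschitzOn.of_lipschitzWith (hKA.min hKB) hSb).inv
      (c := min (a * (ε₂ / 2)) (b * (ε₂ / 2))) (by positivity)
      fun v hv => min_le_min (hAS v hv) (hBS v hv)
  let χ : E → ℝ := fun v => thickenedIndicator hε (closure B \ A) v
  have hχS : ∀ v ∉ S, χ v = 0 := fun v hv => by
    simp only [χ, thickenedIndicator_zero hε _ hv, NNReal.coe_zero]
  have hχ : BoundedLipschitzOn χ univ := by
    have h1 := lipschitzWith_thickenedIndicator hε (closure B \ A)
    refine ⟨max 1 (ε.toNNReal⁻¹ : ℝ≥0), zero_le_one.trans (le_max_left _ _), fun v _ => ?_,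
      fun v _ y _ => ?_⟩
    · rw [Real.norm_of_nonneg (NNReal.coe_nonneg _)]
      refine le_trans ?_ (le_max_left _ _)
      exact_mod_cast thickenedIndicator_le_one hε _ v
    · have := h1.dist_le_mul v y
      rw [NNReal.dist_eq, dist_eq_norm] at this
      exact this.trans (by gcongr; exact le_max_right _ _)
  obtain ⟨K, hK⟩ := hχ.exists_lipschitzWith_smul hχS
    ((hLM.sub hLA).smul (BoundedLipschitzOn.of_lipschitzWith LipschitzWith.id hSb))
  refine ⟨χ, K, fun v hv => hχS v fun hvS => hv (hSU hvS), fun v hv => ?_, hK⟩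
  simp only [χ, thickenedIndicator_one hε _ hv, NNReal.coe_one]

variable (μ) in
/-- The union of two bounded open convex sets which contain the origin can be pushed onto the first
one by a map which moves points only near the second one. -/
theorem exists_image_union_eq_of_zero_mem {A B U : Set E} (hA : Convex ℝ A) (hAo : IsOpen A)
    (hAb : Bornology.IsBounded A) (hA0 : (0 : E) ∈ A) (hB : Convex ℝ B) (hBo : IsOpen B)
    (hBb : Bornology.IsBounded B) (hB0 : (0 : E) ∈ B) (hU : IsOpen U) (hBU : closure B ⊆ U) :
    ∃ e : E ≃ₜ E, IsOrientedBilipschitz μ e ∧ e '' (A ∪ B) = A ∧ ∀ v ∉ U, e v = v := by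
  obtain ⟨χ, K, hχU, hχB, hK⟩ := exists_radial_field hA hAo hAb hA0 hB hBo hBb hB0 hU hBU
  have hAn := hAo.mem_nhds hA0
  have hBn := hBo.mem_nhds hB0
  have hgA : ∀ v, gauge A v < 1 ↔ v ∈ A := fun v => by
    rw [gauge_lt_one_iff_mem_interior hA hAn, hAo.interior_eq]
  have hgB : ∀ v, gauge B v < 1 ↔ v ∈ B := fun v => by
    rw [gauge_lt_one_iff_mem_interior hB hBn, hBo.interior_eq]
  have hgAc := continuous_gauge hA hAn
  have hgBc := continuous_gauge hB hBn
  obtain ⟨a, ha, haA⟩ := exists_mul_norm_le_gauge hAn hAb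
  obtain ⟨b, hb, hbB⟩ := exists_mul_norm_le_gauge hBn hBb
  set N : E → ℝ := gauge A with hN
  set M : E → ℝ := fun v => min (gauge A v) (gauge B v) with hM
  have hMc : Continuous M := hgAc.min hgBc
  have hN0 : N 0 = 0 := gauge_zero
  have hM0 : M 0 = 0 := by simp [M]
  have hMlt : ∀ v, M v < 1 ↔ v ∈ A ∪ B := fun v => by
    simp only [M, min_lt_iff, ← hN, hgA, hgB, mem_union]
  have hNs : ∀ (s : ℝ) (v : E), 0 ≤ s → N (s • v) = s * N v := fun s v hs =>
    gauge_smul_of_nonneg hs v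
  have hMs : ∀ (s : ℝ) (v : E), 0 ≤ s → M (s • v) = s * M v := fun s v hs => by
    simp only [M, gauge_smul_of_nonneg hs, smul_eq_mul, mul_min_of_nonneg _ _ hs]
  have hMN : ∀ v, M v ≤ N v := fun v => min_le_left _ _
  have hMpos : ∀ v, v ≠ 0 → 0 < M v := fun v hv => by
    have := norm_pos_iff.2 hv
    exact lt_min ((by positivity : 0 < a * ‖v‖).trans_le (haA v))
      ((by positivity : 0 < b * ‖v‖).trans_le (hbB v))
  -- With `T > K`, the field divided by `T` is a contraction; `T` iterations restore the full
  -- displacement.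
  obtain ⟨T, hT⟩ := exists_nat_gt K
  have hT0 : (0 : ℝ≥0) < T := bot_le.trans_lt hT
  have hTr : (0 : ℝ) < T := by exact_mod_cast hT0
  have hw : LipschitzWith ((T : ℝ≥0)⁻¹ * K)
      fun v => -((T : ℝ)⁻¹ • χ v • ((M v)⁻¹ - (N v)⁻¹) • v) := by
    refine LipschitzWith.neg (LipschitzWith.of_dist_le_mul fun x y => ?_)
    rw [dist_smul₀, norm_inv, Real.norm_natCast, NNReal.coe_mul, mul_assoc]
    gcongr
    · simp
    · exact hK.dist_le_mul x y
  obtain ⟨h, hh, hhv⟩ := IsOrientedBilipschitz.exists_id_add μ hw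
    (by rwa [inv_mul_lt_iff₀ hT0, mul_one])
  obtain ⟨e, he, heh⟩ := hh.exists_iterate T
  have hfix : ∀ v, χ v • ((M v)⁻¹ - (N v)⁻¹) • v = 0 → e v = v := fun v hv => by
    rw [heh]
    exact Function.iterate_fixed (by rw [hhv, hv]; simp) T
  -- Without the cutoff the field is homogeneous of degree zero, hence constant along a ray. The
  -- point therefore moves from `v` to `v / N v` in `T` equal steps.
  have hiter : ∀ v, M v = 1 → ∀ k : ℕ, k ≤ T →
      h^[k] v = (1 - (k / T : ℝ) * (1 - (N v)⁻¹)) • v := by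
    intro v hv k
    have hN1 : 1 ≤ N v := hv ▸ hMN v
    induction k with
    | zero => intro _; simp
    | succ k ih =>
      intro hk
      rw [Function.iterate_succ_apply', ih (by omega), hhv]
      have hkT : (k / T : ℝ) ≤ 1 := by
        rw [div_le_one hTr]; exact_mod_cast (by omega : k ≤ T)
      have hkT0 : (0 : ℝ) ≤ k / T := by positivity
      have hinv : (N v)⁻¹ ≤ 1 := inv_le_one_of_one_le₀ hN1
      have hinv0 : 0 < (N v)⁻¹ := inv_pos.2 (by linarith)
      set s : ℝ := 1 - (k / T : ℝ) * (1 - (N v)⁻¹) with hs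
      have hs1 : s ≤ 1 := by nlinarith
      have hsN : (N v)⁻¹ ≤ s := by nlinarith
      have hs0 : 0 < s := by linarith
      have hcoef : χ (s • v) • ((M (s • v))⁻¹ - (N (s • v))⁻¹) • s • v = (1 - (N v)⁻¹) • v := by
        rw [hMs s v hs0.le, hNs s v hs0.le, hv, mul_one, mul_inv, smul_smul _ s,
          show (s⁻¹ - s⁻¹ * (N v)⁻¹) * s = 1 - (N v)⁻¹ by field_simp]
        -- If `N v = 1`, the displacement vanishes whatever `χ` is. Otherwise `gauge B v = 1`, and
        -- `(N v)⁻¹ ≤ s ≤ 1` puts `s • v` in `closure B \ A`, where `χ = 1`.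
        rcases hN1.eq_or_lt with h1 | h1
        · simp [← h1]
        · have hgv : gauge B v = 1 := by
            rcases min_choice (gauge A v) (gauge B v) with hc | hc
            · exact absurd (hc.symm.trans hv) h1.ne'
            · exact hc.symm.trans hv
          rw [hχB, one_smul]
          refine ⟨(gauge_le_one_iff_mem_closure hB hBn).1 ?_, fun hmem => ?_⟩
          · rw [gauge_smul_of_nonneg hs0.le, hgv, smul_eq_mul, mul_one]
            exact hs1
          · have h2 := (hgA _).2 hmem
            rw [hNs s v hs0.le] at h2
            have h3 : (N v)⁻¹ * N v = 1 := inv_mul_cancel₀ (by linarith)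
            nlinarith
      rw [hcoef, smul_smul, ← neg_smul, ← add_smul]
      congr 1
      rw [hs]
      push_cast
      ring
  have hlevel : ∀ v, M v = 1 → e v = (N v)⁻¹ • v := fun v hv => by
    rw [heh, hiter v hv T le_rfl, div_self hTr.ne']
    congr 1
    ring
  have he0 : e 0 = 0 := hfix 0 (by simp)
  refine ⟨e, he, Subset.antisymm ?_ fun y hy => ?_, fun v hv => hfix v (by rw [hχU v hv, zero_smul])⟩
  · rintro _ ⟨v, hv, rfl⟩
    by_contra hne
    have hpre : IsPreconnected (A ∪ B) :=
      hA.isPreconnected.union 0 hA0 hB0 hB.isPreconnected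
    -- If the image left `A`, some `z` in the union would have `N (e z) = 1`. The point of `{M = 1}`
    -- on the ray of `e z` is also sent to `e z`, so by injectivity it is `z`, contradicting `M z <
    -- 1`.
    obtain ⟨z, hz, hz1⟩ := hpre.intermediate_value (Or.inl hA0) hv
      (f := fun v => N (e v)) (hgAc.comp e.continuous).continuousOn
      (⟨by simp [he0, hN0], not_lt.1 fun hlt => hne ((hgA _).1 hlt)⟩ : (1 : ℝ) ∈ Icc _ _)
    have hz1 : N (e z) = 1 := hz1
    have hez : e z ≠ 0 := fun h0 => by rw [h0, hN0] at hz1; exact zero_ne_one hz1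
    have hMe := hMpos _ hez
    have hv' : M ((M (e z))⁻¹ • e z) = 1 := by
      rw [hMs _ _ (inv_pos.2 hMe).le, inv_mul_cancel₀ hMe.ne']
    have hev' := hlevel _ hv'
    rw [hNs _ _ (inv_pos.2 hMe).le, hz1, mul_one, inv_inv, smul_smul, mul_inv_cancel₀ hMe.ne',
      one_smul] at hev'
    rw [e.injective hev'] at hv'
    exact ((hMlt z).2 hz).ne hv'
  · rw [← e.apply_symm_apply y]
    refine mem_image_of_mem e ?_
    by_contra hne
    -- Conversely, a preimage outside the union would give `z ∈ A` with `M (e.symm z) = 1`; then `N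
    -- z = 1`, which is impossible in the open set `A`.
    obtain ⟨z, hz, hz1⟩ := hA.isPreconnected.intermediate_value hA0 hy
      (f := fun v => M (e.symm v)) (hMc.comp e.symm.continuous).continuousOn
      (⟨by rw [← he0, e.symm_apply_apply, hM0]; exact zero_le_one,
        not_lt.1 fun hlt => hne ((hMlt _).1 hlt)⟩ : (1 : ℝ) ∈ Icc _ _)
    have hz1 : M (e.symm z) = 1 := hz1
    have h1 := hlevel _ hz1
    have hNpos : 0 < N (e.symm z) := zero_lt_one.trans_le (hz1 ▸ hMN _)
    rw [e.apply_symm_apply] at h1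
    have h2 : N z = 1 := by
      rw [h1, hNs _ _ (inv_pos.2 hNpos).le, inv_mul_cancel₀ hNpos.ne']
    exact ((hgA z).2 hz).ne h2

end Collapse

/-! ### Attaching the balls of the chain one by one -/

section Chain

open scoped Pointwise

variable {E : Type*} [NormedAddCommGroup E] [NormedSpace ℝ E] [MeasurableSpace E]
  [FiniteDimensional ℝ E] [BorelSpace E] (μ : Measure E) [μ.IsAddHaarMeasure]

theorem exists_image_union_eq {A B U : Set E} (hA : Convex ℝ A) (hAo : IsOpen A)
    (hAb : Bornology.IsBounded A) (hB : Convex ℝ B) (hBo : IsOpen B)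
    (hBb : Bornology.IsBounded B) (hAB : (A ∩ B).Nonempty) (hU : IsOpen U) (hBU : closure B ⊆ U) :
    ∃ e : E ≃ₜ E, IsOrientedBilipschitz μ e ∧ e '' (A ∪ B) = A ∧ ∀ v ∉ U, e v = v := by
  obtain ⟨p, hpA, hpB⟩ := hAB
  let t : E ≃ₜ E := Homeomorph.addRight p
  have hbdd : ∀ S : Set E, Bornology.IsBounded S → Bornology.IsBounded (t ⁻¹' S) := fun S hS =>
    (isometry_add_right p).antilipschitz.isBounded_preimage hS
  obtain ⟨e, he, heAB, heU⟩ := exists_image_union_eq_of_zero_mem μ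
    (hA.translate_preimage_left p) (hAo.preimage t.continuous) (hbdd A hAb) (by simpa using hpA)
    (hB.translate_preimage_left p) (hBo.preimage t.continuous) (hbdd B hBb) (by simpa using hpB)
    (hU.preimage t.continuous) ((t.preimage_closure B).symm.trans_subset (preimage_mono hBU))
  obtain ⟨g, hg, hgv⟩ : ∃ g : E ≃ₜ E, IsOrientedBilipschitz μ g ∧ ∀ v, g v = e (v - p) + p :=
    ⟨_, ((IsOrientedBilipschitz.similarity μ one_pos (-p)).trans he).trans
      (IsOrientedBilipschitz.similarity μ one_pos p), fun v => by simp [sub_eq_add_neg]⟩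
  refine ⟨g, hg, Subset.antisymm ?_ fun y hy => ?_, fun v hv => ?_⟩
  · rintro _ ⟨v, hv, rfl⟩
    have h1 : v - p ∈ t ⁻¹' A ∪ t ⁻¹' B := by
      change t (v - p) ∈ A ∪ B
      simpa [t] using hv
    have h2 : e (v - p) ∈ t ⁻¹' A := heAB.subset (mem_image_of_mem e h1)
    rw [hgv]
    exact h2
  · have h1 : y - p ∈ t ⁻¹' A := by simpa [t] using hy
    obtain ⟨v, hv, hvy⟩ := heAB.superset h1
    exact ⟨v + p, hv, by rw [hgv, add_sub_cancel_right, hvy, sub_add_cancel]⟩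
  · rw [hgv, heU _ (by simpa [t] using hv), sub_add_cancel]

theorem exists_image_ball_eq_iUnion {m : ℕ} (x : Fin m → E) (r : Fin m → ℝ) (hr : ∀ j, 0 < r j)
    (hcons : ∀ j k : Fin m, (k : ℕ) = (j : ℕ) + 1 → ‖x k - x j‖ < r j + r k)
    (hdisj : ∀ j k : Fin m, (j : ℕ) + 1 < k →
      closure (ball (x j) (r j)) ∩ closure (ball (x k) (r k)) = ∅) (i : ℕ) (hi : i < m) :
    ∃ e : E ≃ₜ E, IsOrientedBilipschitz μ e ∧
      e '' ball 0 1 = ⋃ j : Fin m, ⋃ _ : (j : ℕ) ≤ i, ball (x j) (r j) := by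
  induction i with
  | zero =>
    refine ⟨_, IsOrientedBilipschitz.similarity μ (hr ⟨0, hi⟩) (x ⟨0, hi⟩), ?_⟩
    have h1 : ⋃ j : Fin m, ⋃ _ : (j : ℕ) ≤ 0, ball (x j) (r j) = ball (x ⟨0, hi⟩) (r ⟨0, hi⟩) := by
      ext v
      simp only [mem_iUnion, exists_prop, Nat.le_zero]
      refine ⟨fun ⟨j, hj, hv⟩ => ?_, fun hv => ⟨_, rfl, hv⟩⟩
      rwa [show j = ⟨0, hi⟩ from Fin.ext hj] at hv
    rw [h1]
    have h2 := smul_unitBall_of_pos (E := E) (hr ⟨0, hi⟩)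
    change (fun v => r ⟨0, hi⟩ • v + x ⟨0, hi⟩) '' _ = _
    rw [← image_image (fun v => v + x ⟨0, hi⟩) (fun v => r ⟨0, hi⟩ • v)]
    change (fun v => v + x ⟨0, hi⟩) '' (r ⟨0, hi⟩ • ball (0 : E) 1) = _
    rw [h2]
    simp
  | succ i ih =>
    obtain ⟨f, hf, hfD⟩ := ih (by omega)
    let J : Fin m := ⟨i + 1, hi⟩
    let I : Fin m := ⟨i, by omega⟩
    -- The strict inequality leaves out ball `i`, which meets ball `i + 1` and must be free to move.
    let Z : Set E := ⋃ j : Fin m, ⋃ _ : (j : ℕ) < i, closure (ball (x j) (r j))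
    have hZ : IsClosed Z := isClosed_iUnion_of_finite fun j =>
      isClosed_iUnion_of_finite fun _ => isClosed_closure
    have hJZ : closure (ball (x J) (r J)) ⊆ Zᶜ := fun v hv hvZ => by
      simp only [Z, mem_iUnion] at hvZ
      obtain ⟨j, hj, hvj⟩ := hvZ
      have := hdisj j J (by simp only [J]; omega)
      exact (this ▸ (⟨hvj, hv⟩ : v ∈ closure (ball (x j) (r j)) ∩ closure (ball (x J) (r J))) :
        v ∈ (∅ : Set E))
    have hne : (ball (x I) (r I) ∩ ball (x J) (r J)).Nonempty := by
      rw [← not_disjoint_iff_nonempty_inter, disjoint_ball_ball_iff (hr I) (hr J), not_le,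
        dist_comm, dist_eq_norm]
      exact hcons I J rfl
    obtain ⟨e, he, heIJ, heZ⟩ := exists_image_union_eq μ (convex_ball _ _) isOpen_ball
      isBounded_ball (convex_ball _ _) isOpen_ball isBounded_ball hne hZ.isOpen_compl hJZ
    -- Since `e` fixes the earlier balls `P` pointwise and collapses the last two onto ball `i`, it
    -- maps the new union onto the old one; `e.symm` reverses this.
    refine ⟨f.trans e.symm, hf.trans he.symm, ?_⟩
    let P : Set E := ⋃ j : Fin m, ⋃ _ : (j : ℕ) < i, ball (x j) (r j)
    have hPZ : P ⊆ Z := iUnion₂_mono fun j _ => subset_closure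
    have heP : e '' P = P := by
      rw [image_congr fun v hv => heZ v (not_not.2 (hPZ hv)), image_id']
    have hD : ⋃ j : Fin m, ⋃ _ : (j : ℕ) ≤ i, ball (x j) (r j) = P ∪ ball (x I) (r I) := by
      ext v
      simp only [P, mem_iUnion, mem_union, exists_prop]
      constructor
      · rintro ⟨j, hj, hv⟩
        rcases hj.lt_or_eq with h | h
        · exact .inl ⟨j, h, hv⟩
        · exact .inr ((show j = I from Fin.ext h) ▸ hv)
      · rintro (⟨j, hj, hv⟩ | hv)
        exacts [⟨j, hj.le, hv⟩, ⟨I, le_rfl, hv⟩]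
    have hD' : ⋃ j : Fin m, ⋃ _ : (j : ℕ) ≤ i + 1, ball (x j) (r j) =
        P ∪ (ball (x I) (r I) ∪ ball (x J) (r J)) := by
      rw [← union_assoc, ← hD]
      ext v
      simp only [mem_iUnion, mem_union, exists_prop]
      constructor
      · rintro ⟨j, hj, hv⟩
        rcases hj.lt_or_eq with h | h
        · exact .inl ⟨j, by omega, hv⟩
        · exact .inr ((show j = J from Fin.ext h) ▸ hv)
      · rintro (⟨j, hj, hv⟩ | hv)
        exacts [⟨j, by omega, hv⟩, ⟨J, le_rfl, hv⟩]
    change e.symm ∘ f '' _ = _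
    rw [image_comp, hfD, hD, hD', e.image_symm]
    conv_lhs => rw [← heP, ← heIJ, ← image_union]
    exact e.injective.preimage_image _

end Chain

end UnionsOfBalls

theorem theorem1p12 {n m : ℕ} (hn : 2 ≤ n) (hm : 1 ≤ m)
    (x : Fin m → EuclideanSpace ℝ (Fin n)) (r : Fin m → ℝ) (hr : ∀ j, 0 < r j)
    (hcons : ∀ j k : Fin m, (k : ℕ) = (j : ℕ) + 1 →
      |r k - r j| < ‖x k - x j‖ ∧ ‖x k - x j‖ < r j + r k)
    (hdisj : ∀ j k : Fin m, 1 < |((j : ℕ) : ℤ) - ((k : ℕ) : ℤ)| →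
      closure (ball (x j) (r j)) ∩ closure (ball (x k) (r k)) = ∅) :
    UnionsOfBalls.IsQuasiball
      ((fun y : EuclideanSpace ℝ (Fin n) => (y : OnePoint (EuclideanSpace ℝ (Fin n)))) ''
        (⋃ j, ball (x j) (r j))) := by
  obtain ⟨e, he, heD⟩ := UnionsOfBalls.exists_image_ball_eq_iUnion volume x r hr
    (fun j k h => (hcons j k h).2)
    (fun j k h => hdisj j k (by rw [abs_sub_comm, lt_abs]; left; omega)) (m - 1) (by omega)
  have hD : ⋃ j, ball (x j) (r j) = e '' ball 0 1 := by
    rw [heD]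
    exact iUnion_congr fun j => by simp [show (j : ℕ) ≤ m - 1 by omega]
  rw [hD]
  exact UnionsOfBalls.isQuasiball_image (by omega) he
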